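/- Conventions. A left-invariant ordering on a group $G$ is a strict linear ordering $<$ on $G$ such that $g<g'$ implies $hg<hg'$ for all $g,g',h\in G$; its positive cone is $\{g\in G : 1<g\}$. The group $G$ is left-orderable if it has such an ordering. The set $\mathrm{LO}(G)$ of all left-invariant orderings on $G$, viewed as subsets of $G\times G$, carries the topology induced by the product topology of $\{0,1\}^{G\times G}$ (with $\{0,1\}$ discrete); an ordering is isolated if it is an isolated point of $\mathrm{LO}(G)$. A monoid $M$ is of right-$O$-type (resp. left-$O$-type) if it is left-cancellative (resp. right-cancellative), $1$ is its only invertible element, and for all $g,h\in M$ one has $h\in gM$ or $g\in hM$ (resp. $h\in Mg$ or $g\in Mh$); $M$ is of $O$-type if it is both of right- and of left-$O$-type. An element $\Delta\in M$ is right-quasi-central if there is an endomorphism $\phi$ of $M$ with $g\Delta=\Delta\,\phi(g)$ for all $g\in M$. (1) Let $p,q,r\ge 1$ and let $M$ be the monoid with presentation $(a,b\,;\ a=b(a^pb^r)^q)$. Then $a^{p+1}$ is right-quasi-central in $M$, and $M$ is of right-$O$-type. If $r=1$, then $a^{p+1}$ is central in $M$, and $M$ is of $O$-type. (2) Let $p,q\ge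 1$ and let $G$ be the torus knot group $\langle x,y \mid x^{p+1}=y^{q+1}\rangle$. Then $G$ is left-orderable, and the subsemigroup of $G$ generated by $x$ and $x^{-p}y$ is the positive cone of a left-invariant ordering on $G$ that is isolated in $\mathrm{LO}(G)$. -/

import Mathlib

/-- `g` is a left-divisor of `h` in the monoid `M`. -/
def LeftDivides {M : Type*} [Monoid M] (g h : M) : Prop := ∃ c : M, g * c = h

/-- `g` is a right-divisor of `h` in the monoid `M`. -/
def RightDivides {M : Type*} [Monoid M] (g h : M) : Prop := ∃ c : M, c * g = h

/-- Monoids of right-`O`-type: left-cancellative, with no nontrivial invertible element, and any two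
elements are comparable for left-divisibility. -/
structure IsRightOType (M : Type*) [Monoid M] : Prop where
  left_cancel : ∀ h g g' : M, h * g = h * g' → g = g'
  eq_one_of_isUnit : ∀ g : M, IsUnit g → g = 1
  comparable : ∀ g h : M, LeftDivides g h ∨ LeftDivides h g

/-- Monoids of left-`O`-type: right-cancellative, with no nontrivial invertible element, and any two
elements are comparable for right-divisibility. -/
structure IsLeftOType (M : Type*) [Monoid M] : Prop where
  right_cancel : ∀ h g g' : M, g * h = g' * h → g = g'
  eq_one_of_isUnit : ∀ g : M, IsUnit g → g = 1
  comparable : ∀ g h : M, RightDivides g h ∨ RightDivides h g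

/-- Monoids of `O`-type. -/
def IsOType (M : Type*) [Monoid M] : Prop := IsRightOType M ∧ IsLeftOType M

/-- `Δ` is right-quasi-central in `M` when some endomorphism `φ` of `M` satisfies
`g Δ = Δ φ(g)` for every `g`. -/
def IsRightQuasiCentral {M : Type*} [Monoid M] (Δ : M) : Prop :=
  ∃ φ : M →* M, ∀ g : M, g * Δ = Δ * φ g

/-- The two generators `a`, `b` of the monoids below. -/
inductive MonoidGen : Type
  | a
  | b

/-- The single relation `a = b (a ^ p * b ^ r) ^ q` on the free monoid on `a`, `b`. -/
inductive TriangularRel (p q r : ℕ) : FreeMonoid MonoidGen → FreeMonoid MonoidGen → Prop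
  | rel : TriangularRel p q r (FreeMonoid.of MonoidGen.a)
      (FreeMonoid.of MonoidGen.b *
        (FreeMonoid.of MonoidGen.a ^ p * FreeMonoid.of MonoidGen.b ^ r) ^ q)

/-- The monoid presented by `(a, b ; a = b (a ^ p * b ^ r) ^ q)`. -/
abbrev TriangularMonoid (p q r : ℕ) : Type := PresentedMonoid (TriangularRel p q r)

/-- The element of `TriangularMonoid p q r` represented by the generator `a`. -/
def TriangularMonoid.a (p q r : ℕ) : TriangularMonoid p q r :=
  PresentedMonoid.of (TriangularRel p q r) MonoidGen.a

/-- The two generators `x`, `y` of the torus knot groups. -/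
inductive TorusGen : Type
  | x
  | y

/-- The torus knot group `⟨x, y | x ^ m = y ^ n⟩`. -/
abbrev TorusKnotGroup (m n : ℕ) : Type :=
  PresentedGroup ({FreeGroup.of TorusGen.x ^ m * (FreeGroup.of TorusGen.y ^ n)⁻¹} :
    Set (FreeGroup TorusGen))

/-- The generator `x` of the torus knot group. -/
def TorusKnotGroup.x (m n : ℕ) : TorusKnotGroup m n := PresentedGroup.of TorusGen.x

/-- The generator `y` of the torus knot group. -/
def TorusKnotGroup.y (m n : ℕ) : TorusKnotGroup m n := PresentedGroup.of TorusGen.y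

/-- A left-invariant ordering on the group `G`: a strict linear ordering `<` such that `g < g'`
implies `h g < h g'`. The type `LeftOrdering G` is the set `LO(G)`. -/
@[ext]
structure LeftOrdering (G : Type*) [Group G] where
  lt : G → G → Prop
  isStrictTotalOrder : IsStrictTotalOrder G lt
  mul_left : ∀ h g g' : G, lt g g' → lt (h * g) (h * g')

/-- The positive cone `{g | 1 < g}` of a left-invariant ordering. -/
def LeftOrdering.positiveCone {G : Type*} [Group G] (o : LeftOrdering G) : Set G :=
  {g | o.lt 1 g}

open scoped Classical in
/-- The topology on `LO(G)`: an ordering is viewed as a subset of `G × G`, given by its indicator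
function `G × G → Bool`, and the power set carries the product of the discrete topologies. -/
noncomputable instance LeftOrdering.instTopologicalSpace (G : Type*) [Group G] :
    TopologicalSpace (LeftOrdering G) :=
  TopologicalSpace.induced (fun (o : LeftOrdering G) (z : G × G) => decide (o.lt z.1 z.2))
    (inferInstance : TopologicalSpace (G × G → Bool))

/-- A group is left-orderable if it admits a left-invariant ordering. -/
def IsLeftOrderable (G : Type*) [Group G] : Prop := Nonempty (LeftOrdering G)

/-!
A one-relator monoid `⟨α | a = b w⟩` with `a ≠ b` is left-cancellative, and two of its elements with
a common right multiple are comparable for left-divisibility. Both facts are proved by induction on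
the number of applications of the relation in a derivation: if such an application touches the first
letter, then dividing everything by `b` on the left makes it disappear.

In a left-cancellative monoid, `g Δ ∈ Δ M` for the generators `g` suffices for `Δ` to be
right-quasi-central. If moreover the generators left-divide `Δ`, every element left-divides a power
of `Δ`, so that any two elements have a common right multiple. For `a = b (a ^ p * b ^ r) ^ q`, the
element `Δ = a ^ (p + 1)` has these properties. When `r = 1`, `Δ` is central and the presentation
is invariant under reversal of words, whence an `O`-type monoid.

An `O`-type monoid embeds in a group by Ore's theorem, hence in the group presented by its
relations, and there its nontrivial elements form a positive cone. This cone is generated by `a`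
and `b` as a semigroup, and an ordering with a finitely generated positive cone is isolated because
finitely many inequalities `1 < s` determine it.
-/

/-! ### One-relator monoids `⟨α | a = b w⟩` -/

section RightTriangular

variable {α : Type*}

/-- The relation of the right-triangular presentation `⟨α | a = b w⟩`. The complement `w` is a list
because derivations are analysed by pattern matching on words. -/
def RightTriangularRel (a b : α) (w : List α) (u v : FreeMonoid α) : Prop :=
  u = .of a ∧ v = .of b * .ofList w

/-- One application, in either direction, of the relation `a = b w` inside a word. -/
inductive TriangularStep (a b : α) (w : List α) : List α → List α → Prop
  | expand (t) : TriangularStep a b w (a :: t) (b :: (w ++ t))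
  | contract (t) : TriangularStep a b w (b :: (w ++ t)) (a :: t)
  | cons (s) {u v} : TriangularStep a b w u v → TriangularStep a b w (s :: u) (s :: v)

/-- Derivations using at most `n` applications of the relation `a = b w`. -/
inductive TriangularChain (a b : α) (w : List α) : ℕ → List α → List α → Prop
  | refl (n u) : TriangularChain a b w n u u
  | step {n u v z} : TriangularStep a b w u v → TriangularChain a b w n v z →
      TriangularChain a b w (n + 1) u z

/-- The quotient by `b` of a word whose first letter is `a` or `b`, where an initial `a` is first
rewritten as `b w`. -/
def stripHead [DecidableEq α] (a : α) (w : List α) : List α → List α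
  | [] => []
  | s :: u => if s = a then w ++ u else u

variable {a b : α} {w u v z : List α} {m n : ℕ}

theorem stripHead_cons_append [DecidableEq α] (s : α) (u v : List α) :
    stripHead a w (s :: u ++ v) = stripHead a w (s :: u) ++ v := by
  simp only [stripHead, List.cons_append]
  split <;> simp

namespace TriangularStep

theorem symm (h : TriangularStep a b w u v) : TriangularStep a b w v u := by
  induction h with
  | expand t => exact .contract t
  | contract t => exact .expand t
  | cons s _ ih => exact .cons s ih

theorem append_left (x : List α) (h : TriangularStep a b w u v) :
    TriangularStep a b w (x ++ u) (x ++ v) := by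
  induction x with
  | nil => exact h
  | cons s x ih => exact .cons s ih

theorem append_right (x : List α) (h : TriangularStep a b w u v) :
    TriangularStep a b w (u ++ x) (v ++ x) := by
  induction h with
  | expand t => simpa using expand (a := a) (b := b) (w := w) (t ++ x)
  | contract t => simpa using contract (a := a) (b := b) (w := w) (t ++ x)
  | cons s _ ih => exact .cons s ih

theorem stripHead_eq_or [DecidableEq α] (hab : a ≠ b) (h : TriangularStep a b w u v) :
    stripHead a w u = stripHead a w v ∨
      TriangularStep a b w (stripHead a w u) (stripHead a w v) := by
  cases h with
  | expand t => exact .inl (by simp [stripHead, hab.symm])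
  | contract t => exact .inl (by simp [stripHead, hab.symm])
  | cons s h =>
    right
    by_cases hs : s = a
    · simpa only [stripHead, if_pos hs] using h.append_left w
    · simpa only [stripHead, if_neg hs] using h

end TriangularStep

namespace TriangularChain

theorem mono (h : TriangularChain a b w m u v) (hmn : m ≤ n) : TriangularChain a b w n u v := by
  induction h generalizing n with
  | refl => exact .refl _ _
  | step h _ ih =>
    obtain ⟨n, rfl⟩ := Nat.exists_eq_add_of_le' (Nat.one_le_of_lt hmn)
    exact .step h (ih (by omega))

theorem single (h : TriangularStep a b w u v) : TriangularChain a b w 1 u v := .step h (.refl 0 _)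

theorem trans (h : TriangularChain a b w m u v) (h' : TriangularChain a b w n v z) :
    TriangularChain a b w (m + n) u z := by
  induction h with
  | refl => exact h'.mono (by omega)
  | step h _ ih => exact (TriangularChain.step h (ih h')).mono (by omega)

theorem symm (h : TriangularChain a b w n u v) : TriangularChain a b w n v u := by
  induction h with
  | refl => exact .refl _ _
  | step h _ ih => exact ih.trans (single h.symm)

theorem append_left (x : List α) (h : TriangularChain a b w n u v) :
    TriangularChain a b w n (x ++ u) (x ++ v) := by
  induction h with
  | refl => exact .refl _ _
  | step h _ ih => exact .step (h.append_left x) ih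

theorem append_right (x : List α) (h : TriangularChain a b w n u v) :
    TriangularChain a b w n (u ++ x) (v ++ x) := by
  induction h with
  | refl => exact .refl _ _
  | step h _ ih => exact .step (h.append_right x) ih

theorem stripHead [DecidableEq α] (hab : a ≠ b) (h : TriangularChain a b w n u v) :
    TriangularChain a b w n (stripHead a w u) (stripHead a w v) := by
  induction h with
  | refl => exact .refl _ _
  | step h _ ih =>
    rcases h.stripHead_eq_or hab with h | h
    · rw [h]
      exact ih.mono (by omega)
    · exact .step h ih

/-- Either the derivation leaves the first letter alone, or it applies the relation at the first
letter and this application is lost after division by `b`. -/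
theorem tail_or_stripHead [DecidableEq α] (hab : a ≠ b) {s t : α}
    (h : TriangularChain a b w n (s :: u) (t :: v)) :
    (s = t ∧ TriangularChain a b w n u v) ∨
      ((s = a ∨ s = b) ∧ (t = a ∨ t = b) ∧ ∃ m < n,
        TriangularChain a b w m (_root_.stripHead a w (s :: u))
          (_root_.stripHead a w (t :: v))) := by
  generalize hx : s :: u = x at h
  generalize hy : t :: v = y at h
  induction h generalizing s u with
  | refl =>
    obtain ⟨rfl, rfl⟩ := List.cons_eq_cons.1 (hx.trans hy.symm)
    exact .inl ⟨rfl, .refl _ _⟩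
  | @step n _ _ _ h chain ih =>
    subst hy
    cases h with
    | expand x =>
      have ht : t = a ∨ t = b := (ih rfl rfl).elim (fun h ↦ .inr h.1.symm) (fun h ↦ h.2.1)
      refine .inr ⟨.inl (List.cons_eq_cons.1 hx).1, ht, n, n.lt_succ_self, ?_⟩
      simpa [_root_.stripHead, hab.symm] using chain.stripHead hab
    | contract x =>
      have ht : t = a ∨ t = b := (ih rfl rfl).elim (fun h ↦ .inl h.1.symm) (fun h ↦ h.2.1)
      refine .inr ⟨.inr (List.cons_eq_cons.1 hx).1, ht, n, n.lt_succ_self, ?_⟩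
      simpa [_root_.stripHead, hab.symm] using chain.stripHead hab
    | cons s' h =>
      obtain ⟨rfl, rfl⟩ := List.cons_eq_cons.1 hx
      rcases ih rfl rfl with ⟨rfl, htail⟩ | ⟨hs, ht, m, hm, hstrip⟩
      · exact .inl ⟨rfl, .step h htail⟩
      · refine .inr ⟨hs, ht, m + 1, by omega, ?_⟩
        rcases (TriangularStep.cons s h).stripHead_eq_or hab with h | h
        · rw [h]
          exact hstrip.mono m.le_succ
        · exact .step h hstrip

theorem of_append_left (hab : a ≠ b) (x : List α)
    (h : TriangularChain a b w n (x ++ u) (x ++ v)) : TriangularChain a b w n u v := by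
  classical
  induction n using Nat.strong_induction_on generalizing x with
  | _ n ihn =>
    induction x with
    | nil => exact h
    | cons s x ihx =>
      rcases tail_or_stripHead hab h with ⟨-, htail⟩ | ⟨-, -, m, hm, hstrip⟩
      · exact ihx htail
      · have hstrip' : TriangularChain a b w m (_root_.stripHead a w (s :: x) ++ u)
            (_root_.stripHead a w (s :: x) ++ v) := by
          rw [← stripHead_cons_append, ← stripHead_cons_append]
          exact hstrip
        exact (ihn m hm _ hstrip').mono hm.le

end TriangularChain

end RightTriangular

/-! ### Divisibility in right-triangular monoids -/

theorem LeftDivides.mul_left {M : Type*} [Monoid M] {g h : M} (k : M) :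
    LeftDivides g h → LeftDivides (k * g) (k * h) := by
  rintro ⟨c, rfl⟩
  exact ⟨c, mul_assoc k g c⟩

section RightTriangular

variable {α : Type*} (a b : α) (w : List α)

/-- The monoid `⟨α | a = b w⟩`. -/
abbrev RightTriangularMonoid : Type _ := PresentedMonoid (RightTriangularRel a b w)

namespace RightTriangularMonoid

/-- The element represented by a word. -/
def ofWord (u : List α) : RightTriangularMonoid a b w := PresentedMonoid.mk _ (.ofList u)

variable {a b w}

theorem ofWord_cons (s : α) (u : List α) :
    ofWord a b w (s :: u) = ofWord a b w [s] * ofWord a b w u := rfl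

theorem ofWord_surjective : Function.Surjective (ofWord a b w) := PresentedMonoid.surjective_mk

theorem ofWord_cons_eq (u : List α) : ofWord a b w (a :: u) = ofWord a b w (b :: (w ++ u)) :=
  congrArg (· * ofWord a b w u) <|
    PresentedMonoid.mk_eq_mk_of_rel (rels := RightTriangularRel a b w) ⟨rfl, rfl⟩

theorem ofWord_eq_of_step {u v : List α} (h : TriangularStep a b w u v) :
    ofWord a b w u = ofWord a b w v := by
  induction h with
  | expand t => exact ofWord_cons_eq t
  | contract t => exact (ofWord_cons_eq t).symm
  | cons s _ ih => rw [ofWord_cons, ih, ← ofWord_cons]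

theorem ofWord_eq_ofWord_iff {u v : List α} :
    ofWord a b w u = ofWord a b w v ↔ ∃ n, TriangularChain a b w n u v := by
  constructor
  · intro h
    have hcon : ConGen.Rel (RightTriangularRel a b w) (.ofList u) (.ofList v) :=
      PresentedMonoid.mk_eq_mk_iff.1 h
    suffices ∀ x y, ConGen.Rel (RightTriangularRel a b w) x y →
        ∃ n, TriangularChain a b w n x.toList y.toList from this _ _ hcon
    intro x y hxy
    induction hxy with
    | of x y h =>
      obtain ⟨rfl, rfl⟩ := h
      exact ⟨1, .single (by simpa using TriangularStep.expand (a := a) (b := b) (w := w) [])⟩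
    | refl x => exact ⟨0, .refl _ _⟩
    | symm _ ih =>
      obtain ⟨n, hn⟩ := ih
      exact ⟨n, hn.symm⟩
    | trans _ _ ih₁ ih₂ =>
      obtain ⟨m, hm⟩ := ih₁
      obtain ⟨n, hn⟩ := ih₂
      exact ⟨m + n, hm.trans hn⟩
    | mul _ _ ih₁ ih₂ =>
      obtain ⟨m, hm⟩ := ih₁
      obtain ⟨n, hn⟩ := ih₂
      exact ⟨m + n, (hm.append_right _).trans (hn.append_left _)⟩
  · rintro ⟨n, h⟩
    induction h with
    | refl => rfl
    | step h _ ih => exact (ofWord_eq_of_step h).trans ih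

theorem isLeftCancelMul (hab : a ≠ b) : IsLeftCancelMul (RightTriangularMonoid a b w) where
  mul_left_cancel g g₁ g₂ h := by
    obtain ⟨x, rfl⟩ := ofWord_surjective g
    obtain ⟨u, rfl⟩ := ofWord_surjective g₁
    obtain ⟨v, rfl⟩ := ofWord_surjective g₂
    obtain ⟨n, hn⟩ := ofWord_eq_ofWord_iff.1 h
    exact ofWord_eq_ofWord_iff.2 ⟨n, hn.of_append_left hab x⟩

theorem ofWord_cons_eq_mul_stripHead [DecidableEq α] {s : α} (hab : a ≠ b) (hs : s = a ∨ s = b)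
    (u : List α) :
    ofWord a b w (s :: u) = ofWord a b w [b] * ofWord a b w (stripHead a w (s :: u)) := by
  rcases hs with rfl | rfl
  · rw [ofWord_cons_eq, ofWord_cons, stripHead, if_pos rfl]
  · rw [ofWord_cons, stripHead, if_neg hab.symm]

theorem leftDivides_or_of_chain (hab : a ≠ b) {n : ℕ} {u v x y : List α}
    (h : TriangularChain a b w n (u ++ x) (v ++ y)) :
    LeftDivides (ofWord a b w u) (ofWord a b w v) ∨
      LeftDivides (ofWord a b w v) (ofWord a b w u) := by
  classical
  induction n using Nat.strong_induction_on generalizing u v x y with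
  | _ n ihn =>
    induction u generalizing v with
    | nil => exact .inl ⟨ofWord a b w v, one_mul _⟩
    | cons s u ihu =>
      cases v with
      | nil => exact .inr ⟨ofWord a b w (s :: u), one_mul _⟩
      | cons t v =>
        rcases TriangularChain.tail_or_stripHead hab h with
          ⟨rfl, htail⟩ | ⟨hs, ht, m, hm, hstrip⟩
        · exact (ihu htail).imp (.mul_left (ofWord a b w [s])) (.mul_left (ofWord a b w [s]))
        · have hstrip' : TriangularChain a b w m (stripHead a w (s :: u) ++ x)
              (stripHead a w (t :: v) ++ y) := by
            rw [← stripHead_cons_append, ← stripHead_cons_append]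
            exact hstrip
          rw [ofWord_cons_eq_mul_stripHead hab hs, ofWord_cons_eq_mul_stripHead hab ht]
          exact (ihn m hm hstrip').imp (.mul_left _) (.mul_left _)

theorem leftDivides_or_of_mul_eq_mul (hab : a ≠ b) {g h c d : RightTriangularMonoid a b w}
    (e : g * c = h * d) : LeftDivides g h ∨ LeftDivides h g := by
  obtain ⟨u, rfl⟩ := ofWord_surjective g
  obtain ⟨v, rfl⟩ := ofWord_surjective h
  obtain ⟨x, rfl⟩ := ofWord_surjective c
  obtain ⟨y, rfl⟩ := ofWord_surjective d
  obtain ⟨n, hn⟩ := ofWord_eq_ofWord_iff.1 e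
  exact leftDivides_or_of_chain hab hn

end RightTriangularMonoid

end RightTriangular

theorem isUnit_presentedMonoid_mk_iff {α : Type*} {rels : FreeMonoid α → FreeMonoid α → Prop}
    (hrels : ∀ u v, rels u v → u ≠ 1 ∧ v ≠ 1) {u : FreeMonoid α} :
    IsUnit (PresentedMonoid.mk rels u) ↔ u = 1 := by
  have lift_zero : ∀ u : FreeMonoid α, u ≠ 1 → FreeMonoid.lift (fun _ ↦ (0 : ℕ)) u = 0 := by
    intro u hu
    cases u with
    | one => exact absurd rfl hu
    | of_mul s u => rw [map_mul, FreeMonoid.lift_eval_of, zero_mul]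
  let f : PresentedMonoid rels →* ℕ := PresentedMonoid.lift (fun _ ↦ 0) fun u v h ↦ by
    rw [lift_zero u (hrels u v h).1, lift_zero v (hrels u v h).2]
  refine ⟨fun h ↦ ?_, fun h ↦ by simp [h]⟩
  by_contra hu
  have hf : IsUnit (f (PresentedMonoid.mk rels u)) := h.map f
  exact not_isUnit_zero (lift_zero u hu ▸ hf)

/-! ### Right-quasi-central elements -/

section QuasiCentral

variable {M : Type*} [Monoid M] {Δ : M} {S : Set M}

theorem isRightQuasiCentral_of_closure_eq_top (hΔ : IsLeftRegular Δ)
    (hS : Submonoid.closure S = ⊤) (h : ∀ s ∈ S, ∃ t, s * Δ = Δ * t) :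
    IsRightQuasiCentral Δ := by
  have exists_conj : ∀ g, ∃ t, g * Δ = Δ * t := by
    intro g
    induction hS ▸ Submonoid.mem_top g using Submonoid.closure_induction with
    | mem s hs => exact h s hs
    | one => exact ⟨1, by rw [one_mul, mul_one]⟩
    | mul g g' _ _ ih ih' =>
      obtain ⟨t, ht⟩ := ih
      obtain ⟨t', ht'⟩ := ih'
      exact ⟨t * t', by rw [mul_assoc, ht', ← mul_assoc, ht, mul_assoc]⟩
  choose φ hφ using exists_conj
  refine ⟨⟨⟨φ, hΔ ?_⟩, fun g g' ↦ hΔ ?_⟩, hφ⟩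
  · change Δ * φ 1 = Δ * 1
    rw [← hφ, one_mul, mul_one]
  · change Δ * φ (g * g') = Δ * (φ g * φ g')
    rw [← hφ, mul_assoc, hφ g', ← mul_assoc, hφ g, mul_assoc]

theorem IsRightQuasiCentral.pow (h : IsRightQuasiCentral Δ) (n : ℕ) :
    IsRightQuasiCentral (Δ ^ n) := by
  obtain ⟨φ, hφ⟩ := h
  induction n with
  | zero => exact ⟨.id M, fun g ↦ by simp⟩
  | succ n ih =>
    obtain ⟨ψ, hψ⟩ := ih
    refine ⟨φ.comp ψ, fun g ↦ ?_⟩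
    rw [pow_succ, ← mul_assoc, hψ, mul_assoc, hφ, ← mul_assoc, MonoidHom.comp_apply]

theorem IsRightQuasiCentral.exists_leftDivides_pow (h : IsRightQuasiCentral Δ)
    (hΔ : IsLeftRegular Δ) (hS : Submonoid.closure S = ⊤) (hdvd : ∀ s ∈ S, LeftDivides s Δ)
    (g : M) : ∃ n, LeftDivides g (Δ ^ n) := by
  induction hS ▸ Submonoid.mem_top g using Submonoid.closure_induction with
  | mem s hs => exact ⟨1, by simpa only [pow_one] using hdvd s hs⟩
  | one => exact ⟨0, 1, by simp⟩
  | mul g₁ g₂ _ _ ih₁ ih₂ =>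
    obtain ⟨m, c, hc⟩ := ih₁
    obtain ⟨n, d, hd⟩ := ih₂
    obtain ⟨φ, hφ⟩ := h.pow n
    have φ_Δ : φ Δ = Δ := hΔ.pow n <| show Δ ^ n * φ Δ = Δ ^ n * Δ by
      rw [← hφ, ← pow_succ, pow_succ']
    refine ⟨n + m, d * φ c, ?_⟩
    calc g₁ * g₂ * (d * φ c) = g₁ * Δ ^ n * φ c := by rw [← hd]; simp only [mul_assoc]
      _ = Δ ^ n * φ (g₁ * c) := by rw [hφ, map_mul, mul_assoc]
      _ = Δ ^ (n + m) := by rw [hc, map_pow, φ_Δ, pow_add]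

theorem IsRightQuasiCentral.exists_mul_eq_mul (h : IsRightQuasiCentral Δ)
    (hΔ : IsLeftRegular Δ) (hS : Submonoid.closure S = ⊤) (hdvd : ∀ s ∈ S, LeftDivides s Δ)
    (g₁ g₂ : M) : ∃ c d, g₁ * c = g₂ * d := by
  obtain ⟨m, c, hc⟩ := h.exists_leftDivides_pow hΔ hS hdvd g₁
  obtain ⟨n, d, hd⟩ := h.exists_leftDivides_pow hΔ hS hdvd g₂
  refine ⟨c * Δ ^ n, d * Δ ^ m, ?_⟩
  rw [← mul_assoc, ← mul_assoc, hc, hd, ← pow_add, ← pow_add, add_comm]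

theorem mem_center_of_closure_eq_top (hS : Submonoid.closure S = ⊤)
    (h : ∀ s ∈ S, Commute s Δ) : Δ ∈ Submonoid.center M := by
  refine Submonoid.mem_center_iff.2 fun g ↦ ?_
  induction hS ▸ Submonoid.mem_top g using Submonoid.closure_induction with
  | mem s hs => exact h s hs
  | one => exact Commute.one_left Δ
  | mul _ _ _ _ ih ih' => exact Commute.mul_left ih ih'

end QuasiCentral

/-! ### The relation `a = b (a ^ p * b ^ r) ^ q` -/

section TriangularRelation

variable {M : Type*} [Monoid M] {a b : M} {p q r : ℕ}

theorem pow_succ_mul_pow_succ_eq (h : a = b * (a ^ p * b ^ (r + 1)) ^ q) :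
    a ^ (p + 1) * b ^ (r + 1) = b * a ^ p * b ^ r * a := by
  calc a ^ (p + 1) * b ^ (r + 1) = a * (a ^ p * b ^ (r + 1)) := by rw [pow_succ', mul_assoc]
    _ = b * ((a ^ p * b ^ (r + 1)) ^ q * (a ^ p * b ^ (r + 1))) := by
      rw [← mul_assoc b, ← h]
    _ = b * (a ^ p * b ^ r * b * (a ^ p * b ^ (r + 1)) ^ q) := by
      rw [mul_assoc (a ^ p) (b ^ r), ← pow_succ b, ← pow_succ, ← pow_succ']
    _ = b * a ^ p * b ^ r * (b * (a ^ p * b ^ (r + 1)) ^ q) := by simp only [mul_assoc]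
    _ = b * a ^ p * b ^ r * a := by rw [← h]

theorem commute_pow_succ_of_eq_mul_pow (h : a = b * (a ^ p * b) ^ q) :
    Commute b (a ^ (p + 1)) := by
  have key := pow_succ_mul_pow_succ_eq (r := 0) (by simpa only [zero_add, pow_one] using h)
  simp only [zero_add, pow_one, pow_zero, mul_one] at key
  rw [mul_assoc, ← pow_succ] at key
  exact key.symm

theorem pow_mul_mul_pow_eq {c : M} (h : b * a * c = a) (n : ℕ) : b ^ n * a * c ^ n = a := by
  induction n with
  | zero => simp
  | succ n ih =>
    calc b ^ (n + 1) * a * c ^ (n + 1) = b ^ n * (b * a * c) * c ^ n := by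
          rw [pow_succ b, pow_succ' c]; simp only [mul_assoc]
      _ = a := by rw [h, ih]

theorem exists_mul_pow_succ_eq (hp : 1 ≤ p) (hq : 1 ≤ q) (hr : 1 ≤ r)
    (h : a = b * (a ^ p * b ^ r) ^ q) : ∃ t, b * a ^ (p + 1) = a ^ (p + 1) * t := by
  obtain ⟨r, rfl⟩ := Nat.exists_eq_add_of_le' hr
  let c := a ^ (p - 1) * b ^ (r + 1) * (a ^ p * b ^ (r + 1)) ^ (q - 1)
  have hc : b * a * c = a := by
    calc b * a * c = b * ((a * a ^ (p - 1)) * b ^ (r + 1) *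
          (a ^ p * b ^ (r + 1)) ^ (q - 1)) := by simp only [c, mul_assoc]
      _ = a := by rw [mul_pow_sub_one (by omega), mul_pow_sub_one (by omega), ← h]
  refine ⟨b ^ (r + 1) * c ^ r, ?_⟩
  calc b * a ^ (p + 1) = b * a ^ p * (b ^ r * a * c ^ r) := by
        rw [pow_mul_mul_pow_eq hc, pow_succ, mul_assoc]
    _ = b * a ^ p * b ^ r * a * c ^ r := by simp only [mul_assoc]
    _ = a ^ (p + 1) * (b ^ (r + 1) * c ^ r) := by rw [← pow_succ_mul_pow_succ_eq h, mul_assoc]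

end TriangularRelation

theorem IsRightOType.isLeftOType_of_mulEquiv_mulOpposite {M : Type*} [Monoid M]
    (hM : IsRightOType M) (e : M ≃* Mᵐᵒᵖ) : IsLeftOType M where
  right_cancel h g g' hgg' := by
    refine e.symm.injective.comp MulOpposite.op_injective <|
      hM.left_cancel (e.symm (.op h)) _ _ ?_
    simp only [Function.comp_apply, ← map_mul, ← MulOpposite.op_mul, hgg']
  eq_one_of_isUnit := hM.eq_one_of_isUnit
  comparable g h := by
    refine (hM.comparable (e.symm (.op g)) (e.symm (.op h))).imp ?_ ?_ <;>
    · rintro ⟨c, hc⟩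
      refine ⟨(e c).unop, MulOpposite.op_injective ?_⟩
      simpa using congrArg e hc

namespace TriangularMonoid

/-- The element of `TriangularMonoid p q r` represented by the generator `b`. -/
def b (p q r : ℕ) : TriangularMonoid p q r :=
  PresentedMonoid.of (TriangularRel p q r) MonoidGen.b

variable {p q r : ℕ}

theorem a_eq : a p q r = b p q r * (a p q r ^ p * b p q r ^ r) ^ q := by
  have h := PresentedMonoid.mk_eq_mk_of_rel (TriangularRel.rel (p := p) (q := q) (r := r))
  simp only [map_mul, map_pow] at h
  exact h

theorem closure_pair_eq_top : Submonoid.closure {a p q r, b p q r} = ⊤ := by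
  rw [eq_top_iff, ← PresentedMonoid.closure_range_of, Submonoid.closure_le]
  rintro _ ⟨_ | _, rfl⟩
  · exact Submonoid.subset_closure (.inl rfl)
  · exact Submonoid.subset_closure (.inr rfl)

theorem rel_eq_rightTriangularRel (p q r : ℕ) :
    TriangularRel p q r =
      RightTriangularRel MonoidGen.a MonoidGen.b
        ((FreeMonoid.of MonoidGen.a ^ p * FreeMonoid.of MonoidGen.b ^ r) ^ q).toList := by
  ext u v
  constructor
  · rintro ⟨⟩
    exact ⟨rfl, rfl⟩
  · rintro ⟨rfl, rfl⟩
    exact .rel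

instance : IsLeftCancelMul (TriangularMonoid p q r) := by
  unfold TriangularMonoid
  rw [rel_eq_rightTriangularRel]
  exact RightTriangularMonoid.isLeftCancelMul nofun

theorem leftDivides_or_of_mul_eq_mul {g h c d : TriangularMonoid p q r} (e : g * c = h * d) :
    LeftDivides g h ∨ LeftDivides h g := by
  unfold TriangularMonoid at *
  revert g h c d
  rw [rel_eq_rightTriangularRel]
  intro g h c d e
  have hab : MonoidGen.a ≠ MonoidGen.b := nofun
  exact RightTriangularMonoid.leftDivides_or_of_mul_eq_mul hab e

theorem isUnit_mk_iff {u : FreeMonoid MonoidGen} :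
    IsUnit (PresentedMonoid.mk (TriangularRel p q r) u) ↔ u = 1 :=
  isUnit_presentedMonoid_mk_iff <| by
    rintro _ _ ⟨⟩
    exact ⟨FreeMonoid.of_ne_one _, List.cons_ne_nil _ _⟩

theorem a_ne_one : a p q r ≠ 1 := fun h ↦
  FreeMonoid.of_ne_one _ (isUnit_mk_iff.1 (h ▸ isUnit_one :))

theorem b_ne_one : b p q r ≠ 1 := fun h ↦
  FreeMonoid.of_ne_one _ (isUnit_mk_iff.1 (h ▸ isUnit_one :))

theorem isRightQuasiCentral_a_pow (hp : 1 ≤ p) (hq : 1 ≤ q) (hr : 1 ≤ r) :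
    IsRightQuasiCentral (a p q r ^ (p + 1)) := by
  refine isRightQuasiCentral_of_closure_eq_top (IsLeftRegular.all _) closure_pair_eq_top ?_
  rintro _ (rfl | rfl)
  · exact ⟨a p q r, by rw [← pow_succ, ← pow_succ']⟩
  · exact exists_mul_pow_succ_eq hp hq hr a_eq

theorem leftDivides_a_pow_succ : ∀ s ∈ ({a p q r, b p q r} : Set _),
    LeftDivides s (a p q r ^ (p + 1)) := by
  rintro _ (rfl | rfl)
  · exact ⟨a p q r ^ p, (pow_succ' _ _).symm⟩
  · exact ⟨(a p q r ^ p * b p q r ^ r) ^ q * a p q r ^ p, by rw [← mul_assoc, ← a_eq, pow_succ']⟩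

theorem isRightOType (hp : 1 ≤ p) (hq : 1 ≤ q) (hr : 1 ≤ r) :
    IsRightOType (TriangularMonoid p q r) where
  left_cancel _ _ _ := mul_left_cancel
  eq_one_of_isUnit g hg := by
    obtain ⟨u, rfl⟩ := PresentedMonoid.surjective_mk g
    rw [isUnit_mk_iff.1 hg, map_one]
  comparable g h := by
    obtain ⟨c, d, e⟩ := (isRightQuasiCentral_a_pow hp hq hr).exists_mul_eq_mul
      (IsLeftRegular.all _) closure_pair_eq_top leftDivides_a_pow_succ g h
    exact leftDivides_or_of_mul_eq_mul e

theorem a_pow_mem_center :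
    a p q 1 ^ (p + 1) ∈ Submonoid.center (TriangularMonoid p q 1) := by
  refine mem_center_of_closure_eq_top closure_pair_eq_top ?_
  rintro _ (rfl | rfl)
  · exact Commute.self_pow _ _
  · exact commute_pow_succ_of_eq_mul_pow (q := q) <| by simpa only [pow_one] using a_eq (r := 1)

/-- The anti-automorphism reversing words, which exists because `b (a ^ p * b) ^ q` and its reversal
`(b * a ^ p) ^ q * b` are the same word. -/
def reverseHom (p q : ℕ) : TriangularMonoid p q 1 →* (TriangularMonoid p q 1)ᵐᵒᵖ :=
  PresentedMonoid.lift (fun s ↦ .op (PresentedMonoid.of _ s)) <| by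
    rintro _ _ ⟨⟩
    apply MulOpposite.unop_injective
    have hconj : SemiconjBy (b p q 1) (a p q 1 ^ p * b p q 1) (b p q 1 * a p q 1 ^ p) :=
      (mul_assoc _ _ _).symm
    have hrel := a_eq (p := p) (q := q) (r := 1)
    rw [pow_one (b p q 1)] at hrel
    simp only [map_mul, map_pow, FreeMonoid.lift_eval_of, MulOpposite.unop_mul,
      MulOpposite.unop_pow, MulOpposite.unop_op, pow_one]
    exact hrel.trans (hconj.pow_right q)

theorem unop_reverseHom_unop_reverseHom (g : TriangularMonoid p q 1) :
    (reverseHom p q (reverseHom p q g).unop).unop = g := by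
  let ρ := (MulEquiv.opOp _).symm.toMonoidHom.comp
    ((MonoidHom.op (reverseHom p q)).comp (reverseHom p q))
  have hρ : ρ = .id _ := PresentedMonoid.ext _ fun _ ↦ rfl
  exact DFunLike.congr_fun hρ g

/-- The reversal of words as an isomorphism onto the opposite monoid. -/
def reverseEquiv (p q : ℕ) : TriangularMonoid p q 1 ≃* (TriangularMonoid p q 1)ᵐᵒᵖ where
  __ := reverseHom p q
  invFun g := (reverseHom p q g.unop).unop
  left_inv := unop_reverseHom_unop_reverseHom
  right_inv g := MulOpposite.unop_injective (unop_reverseHom_unop_reverseHom g.unop)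

theorem isOType (hp : 1 ≤ p) (hq : 1 ≤ q) : IsOType (TriangularMonoid p q 1) :=
  have h := isRightOType hp hq le_rfl
  ⟨h, h.isLeftOType_of_mulEquiv_mulOpposite (reverseEquiv p q)⟩

end TriangularMonoid

/-! ### Left-invariant orderings and positive cones -/

namespace LeftOrdering

variable {G : Type*} [Group G]

/-- The left-invariant ordering with a given positive cone: `g < h` when `g⁻¹ * h` is positive. -/
def ofCone (P : Subsemigroup G) (one_notMem : (1 : G) ∉ P)
    (total : ∀ g : G, g ∈ P ∨ g = 1 ∨ g⁻¹ ∈ P) : LeftOrdering G where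
  lt g h := g⁻¹ * h ∈ P
  isStrictTotalOrder :=
    { trichotomous := fun g h hgh hhg ↦ by
        rcases total (g⁻¹ * h) with h' | h' | h'
        · exact absurd h' hgh
        · exact inv_mul_eq_one.1 h'
        · exact absurd (by simpa using h') hhg
      irrefl := fun g ↦ by simpa using one_notMem
      trans := fun g h k hgh hhk ↦ by simpa [mul_assoc] using P.mul_mem hgh hhk }
  mul_left k g h := by simp [mul_assoc]

theorem positiveCone_ofCone (P : Subsemigroup G) (one_notMem : (1 : G) ∉ P)
    (total : ∀ g : G, g ∈ P ∨ g = 1 ∨ g⁻¹ ∈ P) : (ofCone P one_notMem total).positiveCone = P := by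
  ext g
  simp [positiveCone, ofCone]

theorem lt_iff_inv_mul_mem_positiveCone (o : LeftOrdering G) {g h : G} :
    o.lt g h ↔ g⁻¹ * h ∈ o.positiveCone := by
  constructor
  · intro hlt
    simpa [positiveCone] using o.mul_left g⁻¹ _ _ hlt
  · intro hlt
    simpa using o.mul_left g _ _ hlt

theorem mul_mem_positiveCone (o : LeftOrdering G) {g h : G} (hg : g ∈ o.positiveCone)
    (hh : h ∈ o.positiveCone) : g * h ∈ o.positiveCone := by
  have := o.isStrictTotalOrder
  have g_lt : o.lt g (g * h) := by simpa using o.mul_left g _ _ hh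
  exact trans_of o.lt hg g_lt

theorem eq_of_positiveCone_subset {o o' : LeftOrdering G}
    (h : o.positiveCone ⊆ o'.positiveCone) : o = o' := by
  have := o.isStrictTotalOrder
  have := o'.isStrictTotalOrder
  have lt_of_lt : ∀ {g k}, o.lt g k → o'.lt g k := fun hgk ↦
    o'.lt_iff_inv_mul_mem_positiveCone.2 (h (o.lt_iff_inv_mul_mem_positiveCone.1 hgk))
  ext g k
  refine ⟨lt_of_lt, fun hgk ↦ ?_⟩
  rcases trichotomous_of o.lt g k with hlt | rfl | hgt
  · exact hlt
  · exact absurd hgk (irrefl_of o'.lt g)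
  · exact absurd hgk (asymm_of o'.lt (lt_of_lt hgt))

theorem isOpen_setOf_lt (g h : G) : IsOpen {o : LeftOrdering G | o.lt g h} := by
  classical
  refine isOpen_induced_iff.2 ⟨(fun f : G × G → Bool ↦ f (g, h)) ⁻¹' {true}, ?_, ?_⟩
  · exact (isOpen_discrete _).preimage (continuous_apply _)
  · ext o
    simp

theorem isOpen_singleton_of_positiveCone_eq_closure {o : LeftOrdering G} {S : Set G}
    (hS : S.Finite) (ho : o.positiveCone = Subsemigroup.closure S) :
    IsOpen ({o} : Set (LeftOrdering G)) := by
  have singleton_eq : ({o} : Set (LeftOrdering G)) = ⋂ s ∈ S, {o' | o'.lt 1 s} := by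
    ext o'
    simp only [Set.mem_singleton_iff, Set.mem_iInter]
    constructor
    · rintro rfl s hs
      exact ho.symm.subset (Subsemigroup.subset_closure hs)
    · intro h
      let P : Subsemigroup G := ⟨o'.positiveCone, o'.mul_mem_positiveCone⟩
      have hP : Subsemigroup.closure S ≤ P := Subsemigroup.closure_le.2 h
      exact (eq_of_positiveCone_subset (ho.trans_subset hP)).symm
  rw [singleton_eq]
  exact hS.isOpen_biInter fun s _ ↦ isOpen_setOf_lt 1 s

end LeftOrdering

/-! ### Monoids of `O`-type in groups -/

theorem exists_injective_monoidHom_group.{u} {M : Type u} [Monoid M] [IsCancelMul M]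
    (hM : ∀ g h : M, ∃ c d, c * g = d * h) :
    ∃ (G : Type u) (_ : Group G) (f : M →* G), Function.Injective f := by
  obtain ⟨_⟩ : Nonempty (OreLocalization.OreSet (⊤ : Submonoid M)) := by
    refine OreLocalization.nonempty_oreSet_iff.2 ⟨fun g h s e ↦ ⟨1, ?_⟩, fun g s ↦ ?_⟩
    · rw [mul_right_cancel e]
    · obtain ⟨c, d, e⟩ := hM g s
      exact ⟨d, ⟨c, trivial⟩, e⟩
  let f : M →* (OreLocalization (⊤ : Submonoid M) M)ˣ :=
    { toFun := fun g ↦ OreLocalization.numeratorUnit ⟨g, trivial⟩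
      map_one' := Units.ext (map_one OreLocalization.numeratorHom)
      map_mul' := fun g h ↦ Units.ext (map_mul OreLocalization.numeratorHom g h) }
  refine ⟨_, inferInstance, f, fun g h e ↦ ?_⟩
  have div_eq : OreLocalization.oreDiv g (1 : (⊤ : Submonoid M)) = OreLocalization.oreDiv h 1 :=
    congrArg Units.val e
  obtain ⟨u, v, huv, hu⟩ := OreLocalization.oreDiv_eq_iff.1 div_eq
  simp only [OneMemClass.coe_one, mul_one] at hu
  rw [← hu] at huv
  exact (mul_left_cancel huv).symm

namespace IsOType

variable {M : Type*} [Monoid M]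

theorem isCancelMul (hM : IsOType M) : IsCancelMul M where
  mul_left_cancel h g g' := hM.1.left_cancel h g g'
  mul_right_cancel h g g' := hM.2.right_cancel h g g'

theorem exists_mul_eq_mul (hM : IsOType M) (g h : M) : ∃ c d, c * g = d * h := by
  rcases hM.2.comparable g h with ⟨c, hc⟩ | ⟨c, hc⟩
  · exact ⟨c, 1, by rw [hc, one_mul]⟩
  · exact ⟨1, c, by rw [hc, one_mul]⟩

theorem mul_ne_one (hM : IsOType M) {g h : M} (hg : g ≠ 1) : g * h ≠ 1 := by
  have := hM.isCancelMul
  exact fun e ↦ hg (hM.1.eq_one_of_isUnit g (.of_mul_eq_one h e))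

theorem one_notMem_subsemigroupClosure (hM : IsOType M) {S : Set M} (hS : 1 ∉ S) :
    1 ∉ Subsemigroup.closure S := by
  let P : Subsemigroup M := ⟨{1}ᶜ, fun hg _ ↦ hM.mul_ne_one hg⟩
  have hP : Subsemigroup.closure S ≤ P :=
    Subsemigroup.closure_le.2 fun s hs ↦ ne_of_mem_of_not_mem hs hS
  exact fun h ↦ hP h rfl

variable {G : Type*} [Group G] {f : M →* G}

theorem exists_eq_or_eq_inv (hM : IsOType M) (hf : Subgroup.closure (Set.range f) = ⊤) (g : G) :
    ∃ m, f m = g ∨ f m = g⁻¹ := by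
  induction hf ▸ Subgroup.mem_top g using Subgroup.closure_induction_left with
  | one => exact ⟨1, .inl (map_one f)⟩
  | mul_left _ hx g _ ih =>
    obtain ⟨m, rfl⟩ := hx
    obtain ⟨n, rfl | hn⟩ := ih
    · exact ⟨m * n, .inl (map_mul f m n)⟩
    · obtain rfl : (f n)⁻¹ = g := inv_eq_iff_eq_inv.2 hn
      rcases hM.2.comparable m n with ⟨c, rfl⟩ | ⟨c, rfl⟩ <;> exact ⟨c, by simp⟩
  | inv_mul_cancel _ hx g _ ih =>
    obtain ⟨m, rfl⟩ := hx
    obtain ⟨n, rfl | hn⟩ := ih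
    · rcases hM.1.comparable m n with ⟨c, rfl⟩ | ⟨c, rfl⟩ <;> exact ⟨c, by simp⟩
    · exact ⟨n * m, .inr (by rw [map_mul, hn, mul_inv_rev, inv_inv])⟩

theorem exists_positiveCone_eq_closure_image (hM : IsOType M) (hf : Function.Injective f)
    (hrange : Subgroup.closure (Set.range f) = ⊤) {S : Set M} (hS : Submonoid.closure S = ⊤)
    (one_notMem : 1 ∉ S) :
    ∃ o : LeftOrdering G, o.positiveCone = Subsemigroup.closure (f '' S) := by
  have map_closure : (Subsemigroup.closure S).map f.toMulHom = Subsemigroup.closure (f '' S) :=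
    MulHom.map_mclosure _ S
  have eq_one_or_mem : ∀ m, m = 1 ∨ m ∈ Subsemigroup.closure S := fun m ↦ by
    have hm : m ∈ (Submonoid.closure S : Set M) := hS ▸ Submonoid.mem_top m
    rwa [Submonoid.closure_eq_one_union] at hm
  refine ⟨.ofCone _ ?_ fun g ↦ ?_, LeftOrdering.positiveCone_ofCone _ _ _⟩
  · rw [← map_closure]
    rintro ⟨m, hm, hm_one⟩
    obtain rfl : m = 1 := hf (hm_one.trans (map_one f).symm)
    exact hM.one_notMem_subsemigroupClosure one_notMem hm
  · rw [← map_closure]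
    obtain ⟨m, hg⟩ := hM.exists_eq_or_eq_inv hrange g
    rcases eq_one_or_mem m with rfl | hm
    · rw [map_one] at hg
      exact .inr (.inl (hg.elim Eq.symm fun h ↦ inv_eq_one.1 h.symm))
    · exact hg.imp (fun h ↦ ⟨m, hm, h⟩) fun h ↦ .inr ⟨m, hm, h⟩

end IsOType

/-! ### Torus knot groups -/

namespace TorusKnotGroup

theorem x_pow_eq_y_pow (m n : ℕ) : x m n ^ m = y m n ^ n :=
  PresentedGroup.mk_eq_mk_of_mul_inv_mem (Set.mem_singleton _)

variable (p q : ℕ)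

/-- The element `x ^ (-p) * y`, which is the image of the generator `b` of the monoid. -/
abbrev b : TorusKnotGroup (p + 1) (q + 1) := (x (p + 1) (q + 1) ^ p)⁻¹ * y (p + 1) (q + 1)

theorem x_eq : x (p + 1) (q + 1) = b p q * (x (p + 1) (q + 1) ^ p * b p q) ^ q := by
  rw [mul_inv_cancel_left, mul_assoc, ← pow_succ', ← x_pow_eq_y_pow,
    pow_succ (x (p + 1) (q + 1)) p, inv_mul_cancel_left]

/-- The homomorphism mapping `a` to `x` and `b` to `x ^ (-p) * y`. -/
def ofMonoid : TriangularMonoid p q 1 →* TorusKnotGroup (p + 1) (q + 1) :=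
  PresentedMonoid.lift (fun | .a => x (p + 1) (q + 1) | .b => b p q) <| by
    rintro _ _ ⟨⟩
    simpa only [map_mul, map_pow, FreeMonoid.lift_eval_of, pow_one] using x_eq p q

theorem ofMonoid_a : ofMonoid p q (TriangularMonoid.a p q 1) = x (p + 1) (q + 1) := rfl

theorem ofMonoid_b : ofMonoid p q (TriangularMonoid.b p q 1) = b p q := rfl

variable {p q}

theorem closure_range_ofMonoid : Subgroup.closure (Set.range (ofMonoid p q)) = ⊤ := by
  refine (Subgroup.eq_top_iff' _).2 (PresentedGroup.generated_by _ _ ?_)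
  have hx : x (p + 1) (q + 1) ∈ Subgroup.closure (Set.range (ofMonoid p q)) :=
    Subgroup.subset_closure ⟨_, ofMonoid_a p q⟩
  have hb : b p q ∈ Subgroup.closure (Set.range (ofMonoid p q)) :=
    Subgroup.subset_closure ⟨_, ofMonoid_b p q⟩
  rintro (_ | _)
  · exact hx
  · exact (Subgroup.mul_mem_cancel_left _ (inv_mem (pow_mem hx p))).1 hb

theorem exists_comp_ofMonoid_eq {H : Type*} [Group H] (f : TriangularMonoid p q 1 →* H) :
    ∃ φ : TorusKnotGroup (p + 1) (q + 1) →* H, φ.comp (ofMonoid p q) = f := by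
  let α := f (TriangularMonoid.a p q 1)
  let β := f (TriangularMonoid.b p q 1)
  have hα : α = β * (α ^ p * β) ^ q := by
    simpa only [map_mul, map_pow, pow_one] using
      congrArg f (TriangularMonoid.a_eq (p := p) (q := q) (r := 1))
  let φ : TorusKnotGroup (p + 1) (q + 1) →* H :=
    PresentedGroup.toGroup (f := fun | .x => α | .y => α ^ p * β) <| by
      rintro _ rfl
      simp only [map_mul, map_inv, map_pow, FreeGroup.lift_apply_of]
      rw [mul_inv_eq_one, pow_succ' _ q, mul_assoc, ← hα, pow_succ]
  have φ_x : φ (x (p + 1) (q + 1)) = α := PresentedGroup.toGroup.of _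
  have φ_y : φ (y (p + 1) (q + 1)) = α ^ p * β := PresentedGroup.toGroup.of _
  refine ⟨φ, PresentedMonoid.ext _ fun s ↦ ?_⟩
  cases s with
  | a => exact φ_x
  | b =>
    change φ (b p q) = β
    rw [map_mul, map_inv, map_pow, φ_x, φ_y, inv_mul_cancel_left]

theorem ofMonoid_injective (hM : IsOType (TriangularMonoid p q 1)) :
    Function.Injective (ofMonoid p q) := by
  have := hM.isCancelMul
  obtain ⟨H, _, f, hf⟩ := exists_injective_monoidHom_group hM.exists_mul_eq_mul
  obtain ⟨φ, rfl⟩ := exists_comp_ofMonoid_eq f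
  exact .of_comp hf

theorem exists_positiveCone_eq_closure (hp : 1 ≤ p) (hq : 1 ≤ q) :
    ∃ o : LeftOrdering (TorusKnotGroup (p + 1) (q + 1)),
      o.positiveCone = Subsemigroup.closure {x (p + 1) (q + 1), b p q} := by
  have hM := TriangularMonoid.isOType hp hq
  have one_notMem : 1 ∉ ({TriangularMonoid.a p q 1, TriangularMonoid.b p q 1} : Set _) := by
    rintro (h | h)
    · exact TriangularMonoid.a_ne_one h.symm
    · exact TriangularMonoid.b_ne_one h.symm
  have h := hM.exists_positiveCone_eq_closure_image (ofMonoid_injective hM)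
    closure_range_ofMonoid TriangularMonoid.closure_pair_eq_top one_notMem
  rwa [Set.image_pair, ofMonoid_a, ofMonoid_b] at h

end TorusKnotGroup

theorem corollary8p2 :
    -- the monoids `(a, b ; a = b (a ^ p * b ^ r) ^ q)`
    (∀ p q r : ℕ, 1 ≤ p → 1 ≤ q → 1 ≤ r →
      IsRightQuasiCentral (TriangularMonoid.a p q r ^ (p + 1)) ∧
      IsRightOType (TriangularMonoid p q r) ∧
      (r = 1 →
        TriangularMonoid.a p q r ^ (p + 1) ∈ Submonoid.center (TriangularMonoid p q r) ∧
        IsOType (TriangularMonoid p q r))) ∧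
    -- the torus knot groups
    (∀ p q : ℕ, 1 ≤ p → 1 ≤ q →
      IsLeftOrderable (TorusKnotGroup (p + 1) (q + 1)) ∧
      ∃ o : LeftOrdering (TorusKnotGroup (p + 1) (q + 1)),
        o.positiveCone =
          (Subsemigroup.closure {TorusKnotGroup.x (p + 1) (q + 1),
            (TorusKnotGroup.x (p + 1) (q + 1) ^ p)⁻¹ * TorusKnotGroup.y (p + 1) (q + 1)} :
            Set (TorusKnotGroup (p + 1) (q + 1))) ∧
        IsOpen ({o} : Set (LeftOrdering (TorusKnotGroup (p + 1) (q + 1))))) := by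
  refine ⟨fun p q r hp hq hr ↦ ⟨TriangularMonoid.isRightQuasiCentral_a_pow hp hq hr,
    TriangularMonoid.isRightOType hp hq hr, ?_⟩, fun p q hp hq ↦ ?_⟩
  · rintro rfl
    exact ⟨TriangularMonoid.a_pow_mem_center, TriangularMonoid.isOType hp hq⟩
  · obtain ⟨o, ho⟩ := TorusKnotGroup.exists_positiveCone_eq_closure hp hq
    exact ⟨⟨o⟩, o, ho, o.isOpen_singleton_of_positiveCone_eq_closure (Set.toFinite _) ho⟩
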